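/- Let $n\ge 3$ be an integer. An $(n,3,2)$-covering is a pair $(X,\mathcal A)$, where $X$ is a set of $n$ points and $\mathcal A$ is a set of $3$-element subsets of $X$ (blocks) such that every $2$-element subset of $X$ is contained in at least one block; it is *minimum* if $|\mathcal A|$ is as small as possible among all $(n,3,2)$-coverings. A *$2$-shift universal cycle* for $(X,\mathcal A)$ is a cyclic sequence $(u_0,u_1,\ldots,u_{2m-1})$ of points of $X$, where $m=|\mathcal A|$ and indices are read modulo $2m$, such that the sets $\{u_{2i+1},u_{2i+2},u_{2i+3}\}$, $0\le i<m$, run through the blocks in $\mathcal A$, each block occurring exactly once. **Corollary.** For every integer $n\ge 4$ there exists a minimum $(n,3,2)$-covering that has a $2$-shift universal cycle. -/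

import Mathlib

namespace PairCovering

/-- A set system on the finite point set `X` is given by its finite set of blocks `A`. It is a
covering of pairs by triples if all blocks have three points and every pair of points is contained
in some block. For `|X| = n` this is an `(n,3,2)`-covering. -/
def IsCovering {X : Type*} (A : Finset (Finset X)) : Prop :=
  (∀ B ∈ A, B.card = 3) ∧ ∀ T : Finset X, T.card = 2 → ∃ B ∈ A, T ⊆ B

/-- The covering number `C(n,3,2)`: the minimum size of an `(n,3,2)`-covering. (Coverings exist for
all `n ≥ 3`, so the infimum is attained there.) -/
noncomputable def coveringNumber (n : ℕ) : ℕ :=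
  sInf {m : ℕ | ∃ A : Finset (Finset (Fin n)), IsCovering A ∧ A.card = m}

/-- A minimum `(n,3,2)`-covering, where `n = |X|`. -/
def IsMinimumCovering {X : Type*} [Fintype X] (A : Finset (Finset X)) : Prop :=
  IsCovering A ∧ A.card = coveringNumber (Fintype.card X)

/-- The set `{u_{si+1}, u_{si+2}, …, u_{si+k}}` of entries of the `i`-th window of length `k` of a
cyclic sequence `u`; indices are read modulo the length `m` of the sequence. -/
def window {X : Type*} [DecidableEq X] {m : ℕ} (s k : ℕ) (u : ZMod m → X) (i : ℕ) : Finset X :=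
  (Finset.Icc 1 k).image fun j : ℕ => u ((s * i + j : ℕ) : ZMod m)

/-- A cyclic sequence `u = (u_0, …, u_{s|A|-1})` is an `s`-shift universal cycle for the
`k`-uniform set system with blocks `A` if the windows `{u_{si+1}, …, u_{si+k}}`, `0 ≤ i < |A|`,
run through each block of `A` exactly once. -/
def IsShiftUniversalCycle {X : Type*} [DecidableEq X] (s k : ℕ) (A : Finset (Finset X))
    (u : ZMod (s * A.card) → X) : Prop :=
  Set.BijOn (window s k u) (Set.Iio A.card) (A : Set (Finset X))

end PairCovering

namespace PairCovering

/-! Consecutive windows share one point. A universal cycle therefore amounts to choosing an edge in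
each block so that the chosen edges, taken as a multigraph, have a closed Eulerian trail; the third
point of each block is inserted between the ends of its edge.

Such a choice exists once each block is written `{x, y, z}` and the blocks are split into two
classes, in each of which the edges `xy` form a connected spanning graph (`exists_closed_trail`).
The first class uses its edges `xy`, which makes the chosen graph connected. A block of the second
class uses `xz` or `yz`; switching between them changes the degree parities exactly at `x` and `y`.
Since the edges `xy` of the second class are connected, suitable switches make all degrees even.

For `n ≥ 15` the coverings are of Bose and Skolem type on three levels (`exists_cycle_of_levels`),
adapted to each residue of `n` modulo 6. They meet the Schönheim bound, which proves minimality and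
also that the listed triples are distinct. Smaller orders are settled by explicit cycles. -/

/-! ### The Schönheim bound -/

theorem IsCovering.card_mul_half_le {X : Type*} [Fintype X] [DecidableEq X]
    {A : Finset (Finset X)} (h : IsCovering A) :
    Fintype.card X * (Fintype.card X / 2) ≤ 3 * A.card := by
  -- A block through `x` covers two of the other `n - 1` points, and `⌈(n - 1) / 2⌉ = ⌊n / 2⌋`.
  -- Summing over `x` counts each block three times.
  have hdeg : ∀ x : X, Fintype.card X / 2 ≤ (A.filter fun B => x ∈ B).card := by
    intro x
    have hsub : Finset.univ.erase x ⊆ (A.filter fun B => x ∈ B).biUnion fun B => B.erase x := by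
      intro y hy
      have hyx : y ≠ x := by simpa using hy
      obtain ⟨B, hB, hT⟩ := h.2 {x, y} (Finset.card_pair hyx.symm)
      simp only [Finset.mem_biUnion, Finset.mem_filter, Finset.mem_erase]
      exact ⟨B, ⟨hB, hT (by simp)⟩, hyx, hT (by simp)⟩
    have h1 := (Finset.card_le_card hsub).trans (Finset.card_biUnion_le_card_mul _ _ 2 (by
      intro B hB
      rw [Finset.mem_filter] at hB
      rw [Finset.card_erase_of_mem hB.2, h.1 B hB.1]))
    rw [Finset.card_erase_of_mem (Finset.mem_univ x), Finset.card_univ] at h1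
    omega
  have hcount : ∑ x : X, (A.filter fun B => x ∈ B).card = 3 * A.card := by
    have := Finset.sum_card_bipartiteAbove_eq_sum_card_bipartiteBelow
      (s := (Finset.univ : Finset X)) (t := A) (fun x B => x ∈ B)
    simp only [Finset.bipartiteAbove, Finset.bipartiteBelow] at this
    rw [this, Finset.sum_congr rfl (g := fun _ => 3)]
    · simp [mul_comm]
    · intro B hB
      rw [← h.1 B hB]
      congr 1
      ext; simp
  calc Fintype.card X * (Fintype.card X / 2) = ∑ _x : X, Fintype.card X / 2 := by simp
    _ ≤ _ := Finset.sum_le_sum fun x _ => hdeg x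
    _ = _ := hcount

theorem isCovering_image {X I : Type*} [DecidableEq X] [Fintype I] {b : I → Finset X}
    (h3 : ∀ i, (b i).card = 3) (hcov : ∀ x y, x ≠ y → ∃ i, x ∈ b i ∧ y ∈ b i) :
    IsCovering (Finset.univ.image b) := by
  refine ⟨by simpa using h3, fun T hT => ?_⟩
  obtain ⟨x, y, hxy, rfl⟩ := Finset.card_eq_two.mp hT
  obtain ⟨i, hx, hy⟩ := hcov x y hxy
  exact ⟨b i, by simp, by simp [Finset.insert_subset_iff, hx, hy]⟩

/-- A family of triples covering all pairs whose size attains the Schönheim bound consists of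
distinct triples. -/
theorem card_image_of_card_lt {X I : Type*} [Fintype X] [DecidableEq X] [Fintype I]
    {b : I → Finset X} (h3 : ∀ i, (b i).card = 3)
    (hcov : ∀ x y, x ≠ y → ∃ i, x ∈ b i ∧ y ∈ b i)
    (hI : 3 * Fintype.card I < Fintype.card X * (Fintype.card X / 2) + 3) :
    (Finset.univ.image b).card = Fintype.card I := by
  have h1 := (isCovering_image h3 hcov).card_mul_half_le
  have h2 : (Finset.univ.image b).card ≤ Fintype.card I := Finset.card_image_le
  omega

theorem IsCovering.isMinimumCovering {n : ℕ} {A : Finset (Finset (Fin n))} (h : IsCovering A)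
    (hA : 3 * A.card < n * (n / 2) + 3) : IsMinimumCovering A := by
  refine ⟨h, ?_⟩
  rw [Fintype.card_fin]
  refine le_antisymm ?_ (Nat.sInf_le ⟨A, h, rfl⟩)
  refine le_csInf ⟨_, A, h, rfl⟩ ?_
  rintro m ⟨A', hA', rfl⟩
  have := hA'.card_mul_half_le
  rw [Fintype.card_fin] at this
  omega

/-! ### From closed trails to universal cycles -/

/-- The cyclic sequence `(c_{m-1}, p_0, c_0, p_1, c_1, …, p_{m-1})`. -/
def interleave {X : Type*} (m : ℕ) (p c : ℕ → X) (k : ZMod (2 * m)) : X :=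
  if k.val % 2 = 1 then p (k.val / 2) else if k.val = 0 then c (m - 1) else c (k.val / 2 - 1)

theorem window_interleave {X : Type*} [DecidableEq X] {m : ℕ} {p c : ℕ → X} (hp : p m = p 0)
    {i : ℕ} (hi : i < m) : window 2 3 (interleave m p c) i = {p i, c i, p (i + 1)} := by
  have hIcc : Finset.Icc 1 3 = ({1, 2, 3} : Finset ℕ) := rfl
  rw [window, hIcc]
  simp only [Finset.image_insert, Finset.image_singleton]
  have h1 : interleave m p c ((2 * i + 1 : ℕ) : ZMod (2 * m)) = p i := by
    have hv : (((2 * i + 1 : ℕ) : ZMod (2 * m))).val = 2 * i + 1 :=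
      ZMod.val_cast_of_lt (by omega)
    rw [interleave, hv, if_pos (by omega)]
    congr 1; omega
  have h2 : interleave m p c ((2 * i + 2 : ℕ) : ZMod (2 * m)) = c i := by
    rw [interleave, ZMod.val_natCast]
    rcases Nat.lt_or_ge (i + 1) m with h | h
    · rw [Nat.mod_eq_of_lt (by omega : 2 * i + 2 < 2 * m), if_neg (by omega), if_neg (by omega)]
      congr 1; omega
    · rw [show 2 * i + 2 = 2 * m by omega, Nat.mod_self, if_neg (by omega), if_pos rfl]
      congr 1; omega
  have h3 : interleave m p c ((2 * i + 3 : ℕ) : ZMod (2 * m)) = p (i + 1) := by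
    rw [interleave, ZMod.val_natCast]
    rcases Nat.lt_or_ge (i + 1) m with h | h
    · rw [Nat.mod_eq_of_lt (by omega : 2 * i + 3 < 2 * m), if_pos (by omega)]
      congr 1; omega
    · have : (2 * i + 3) % (2 * m) = 1 := by
        rw [show 2 * i + 3 = 1 + 2 * m by omega, Nat.add_mod_right, Nat.mod_eq_of_lt (by omega)]
      rw [this, if_pos rfl, show i + 1 = m by omega, hp]
  rw [h1, h2, h3]

/-- A closed trail `p_0, …, p_m = p_0` through triples `{p_i, c_i, p_{i+1}}` that cover all pairs,
their number attaining the Schönheim bound, is a universal cycle of a minimum covering. -/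
theorem exists_cycle_of_closed_trail {n m : ℕ} (hm : 3 * m < n * (n / 2) + 3) {p c : ℕ → Fin n}
    (hp : p m = p 0) (h3 : ∀ i < m, ({p i, c i, p (i + 1)} : Finset (Fin n)).card = 3)
    (hcov : ∀ x y : Fin n, x ≠ y → ∃ i < m, x ∈ ({p i, c i, p (i + 1)} : Finset (Fin n)) ∧
      y ∈ ({p i, c i, p (i + 1)} : Finset (Fin n))) :
    ∃ A : Finset (Finset (Fin n)), IsMinimumCovering A ∧
      ∃ u : ZMod (2 * A.card) → Fin n, IsShiftUniversalCycle 2 3 A u := by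
  let b : Fin m → Finset (Fin n) := fun i => {p i, c i, p (i + 1)}
  have hb3 : ∀ i, (b i).card = 3 := fun i => h3 i i.2
  have hbcov : ∀ x y, x ≠ y → ∃ i, x ∈ b i ∧ y ∈ b i := fun x y hxy => by
    obtain ⟨i, hi, h⟩ := hcov x y hxy
    exact ⟨⟨i, hi⟩, h⟩
  have hcard := card_image_of_card_lt hb3 hbcov (by simpa using hm)
  rw [Fintype.card_fin] at hcard
  refine ⟨Finset.univ.image b, (isCovering_image hb3 hbcov).isMinimumCovering (by omega), ?_⟩
  have hinj : Function.Injective b := by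
    have := Finset.card_image_iff.mp (hcard.trans (by simp) : _ = (Finset.univ : Finset (Fin m)).card)
    simpa using this
  have key : Set.BijOn (window 2 3 (interleave m p c)) (Set.Iio m) (Finset.univ.image b) := by
    refine ⟨fun i hi => ?_, fun i hi j hj hij => ?_, fun B hB => ?_⟩
    · rw [window_interleave hp hi]
      simp only [Finset.coe_image, Finset.coe_univ, Set.image_univ]
      exact ⟨⟨i, hi⟩, rfl⟩
    · rw [window_interleave hp hi, window_interleave hp hj] at hij
      exact congrArg Fin.val (@hinj ⟨i, hi⟩ ⟨j, hj⟩ hij)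
    · simp only [Finset.coe_image, Finset.coe_univ, Set.image_univ] at hB
      obtain ⟨i, rfl⟩ := hB
      exact ⟨i, i.2, window_interleave hp i.2⟩
  unfold IsShiftUniversalCycle
  -- The index type of the cycle depends on `A.card`; with `A` opaque, `m` can be replaced by it.
  generalize Finset.univ.image b = A at hcard key
  subst hcard
  exact ⟨_, key⟩

/-! ### Eulerian circuits and parity correction -/

section Euler

variable {V E : Type*}

/-- `IsWalk ends a l z`: the edges of `l` form, in this order, a walk from `a` to `z`. -/
def IsWalk (ends : E → Sym2 V) : V → List E → V → Prop
  | a, [], z => a = z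
  | a, e :: l, z => ∃ b, ends e = s(a, b) ∧ IsWalk ends b l z

theorem isWalk_append {ends : E → Sym2 V} {l₁ l₂ : List E} {a z : V} :
    IsWalk ends a (l₁ ++ l₂) z ↔ ∃ b, IsWalk ends a l₁ b ∧ IsWalk ends b l₂ z := by
  induction l₁ generalizing a with
  | nil => simp [IsWalk]
  | cons e l ih =>
    simp only [List.cons_append, IsWalk, ih]
    constructor
    · rintro ⟨b, hb, c, h₁, h₂⟩
      exact ⟨c, ⟨b, hb, h₁⟩, h₂⟩
    · rintro ⟨c, ⟨b, hb, h₁⟩, h₂⟩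
      exact ⟨b, hb, c, h₁, h₂⟩

theorem IsWalk.exists_vertices {ends : E → Sym2 V} {l : List E} {a z : V}
    (h : IsWalk ends a l z) : ∃ p : ℕ → V, p 0 = a ∧ p l.length = z ∧
      ∀ i (hi : i < l.length), ends l[i] = s(p i, p (i + 1)) := by
  induction l generalizing a with
  | nil => exact ⟨fun _ => a, rfl, h, by simp⟩
  | cons e l ih =>
    obtain ⟨b, hb, hl⟩ := h
    obtain ⟨p, h0, h1, h2⟩ := ih hl
    refine ⟨fun i => Nat.casesOn i a p, rfl, by simpa using h1, fun i hi => ?_⟩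
    cases i with
    | zero => simpa [h0] using hb
    | succ i => exact h2 i (by simpa using hi)

variable [DecidableEq V]

/-- The parity contribution of the pair `{x, y}` to the degrees. -/
def pairParity (x y : V) : V → ZMod 2 := Pi.single x 1 + Pi.single y 1

theorem pairParity_comm (x y : V) : pairParity x y = pairParity y x := add_comm _ _

theorem pairParity_self (x : V) : pairParity x x = 0 := by
  ext v; exact CharTwo.add_self_eq_zero _

theorem pairParity_add_pairParity (x y z : V) :
    pairParity x y + pairParity y z = pairParity x z := by
  have h : (Pi.single y 1 + Pi.single y 1 : V → ZMod 2) = 0 := pairParity_self y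
  calc pairParity x y + pairParity y z
      = Pi.single x 1 + (Pi.single y 1 + Pi.single y 1) + Pi.single z 1 := by
        simp only [pairParity]; abel
    _ = pairParity x z := by rw [h, add_zero]; rfl

/-- The parity contribution of an unordered pair to the degrees. -/
def edgeParity (e : Sym2 V) : V → ZMod 2 := Sym2.lift ⟨pairParity, pairParity_comm⟩ e

@[simp] theorem edgeParity_mk (x y : V) : edgeParity s(x, y) = pairParity x y := rfl

theorem edgeParity_apply_of_notMem {e : Sym2 V} {v : V} (h : v ∉ e) : edgeParity e v = 0 := by
  induction e with
  | _ x y =>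
    simp only [Sym2.mem_iff, not_or] at h
    simp [pairParity, h.1, h.2]

theorem IsWalk.sum_edgeParity {ends : E → Sym2 V} {l : List E} {a z : V}
    (h : IsWalk ends a l z) : (l.map fun e => edgeParity (ends e)).sum = pairParity a z := by
  induction l generalizing a with
  | nil => cases h; simp [pairParity_self]
  | cons e l ih =>
    obtain ⟨b, hb, hl⟩ := h
    rw [List.map_cons, List.sum_cons, ih hl, hb, edgeParity_mk, pairParity_add_pairParity]

/-- Euler's theorem for finite multigraphs. -/
theorem exists_eulerian_circuit [Fintype E] [DecidableEq E] {ends : E → Sym2 V}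
    (heven : ∑ e, edgeParity (ends e) = 0)
    (hconn : ∀ x y : V, Relation.EqvGen (fun x y => ∃ e, ends e = s(x, y)) x y) (v : V) :
    ∃ (a : V) (l : List E), IsWalk ends a l a ∧ l.Nodup ∧ ∀ e, e ∈ l := by
  let S : Set ℕ := {k | ∃ a l z, IsWalk ends a l z ∧ l.Nodup ∧ l.length = k}
  have hbdd : BddAbove S := by
    refine ⟨Fintype.card E, ?_⟩
    rintro k ⟨a, l, z, -, hl, rfl⟩
    exact hl.length_le_card
  obtain ⟨k, ⟨a, l, z, hw, hnd, rfl⟩, hmax⟩ :=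
    hbdd.exists_isGreatest_of_nonempty ⟨0, v, [], v, rfl, List.nodup_nil, rfl⟩
  -- A longest trail uses every edge at its end `z`. If it were open, its degree at `z` would be
  -- odd, against `heven`.
  have hclosed : a = z := by
    by_contra hne
    have hused : ∀ e, z ∈ ends e → e ∈ l := by
      intro e he
      by_contra hel
      obtain ⟨w, hw'⟩ := he
      have hmem : l.length + 1 ∈ S :=
        ⟨a, l ++ [e], w, isWalk_append.mpr ⟨z, hw, w, hw', rfl⟩,
          by rw [List.nodup_append_comm]; exact List.nodup_cons.mpr ⟨hel, hnd⟩, by simp⟩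
      have := hmax hmem
      omega
    have h2 : ∑ e ∈ l.toFinset, edgeParity (ends e) z = ∑ e, edgeParity (ends e) z :=
      Finset.sum_subset (Finset.subset_univ _) fun e _ he =>
        edgeParity_apply_of_notMem fun hz => he (List.mem_toFinset.mpr (hused e hz))
    rw [← Finset.sum_apply, ← Finset.sum_apply, List.sum_toFinset _ hnd, hw.sum_edgeParity,
      heven] at h2
    simp [pairParity, Ne.symm hne] at h2
  subst hclosed
  -- The vertices visited by the circuit. Rotated to start at such a vertex, the circuit could be
  -- extended by any unused edge there, so `C` is closed under adjacency.
  let C : V → Prop := fun v => ∃ l₁ l₂, l = l₁ ++ l₂ ∧ IsWalk ends a l₁ v ∧ IsWalk ends v l₂ a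
  have hCmem : ∀ e x y, ends e = s(x, y) → C x → e ∈ l := by
    rintro e x y he ⟨l₁, l₂, rfl, h₁, h₂⟩
    by_contra hel
    have hperm : (l₂ ++ l₁).Perm (l₁ ++ l₂) := List.perm_append_comm
    have hmem : (l₁ ++ l₂).length + 1 ∈ S :=
      ⟨y, e :: (l₂ ++ l₁), x, ⟨x, by rw [he, Sym2.eq_swap], isWalk_append.mpr ⟨a, h₂, h₁⟩⟩,
        List.nodup_cons.mpr ⟨fun h => hel (hperm.mem_iff.mp h), hperm.nodup_iff.mpr hnd⟩,
        by simp [add_comm]⟩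
    have := hmax hmem
    omega
  have hlC : ∀ e x y, ends e = s(x, y) → e ∈ l → C x := by
    intro e x y he hel
    obtain ⟨l₁, l₂, hl⟩ := List.append_of_mem hel
    have hw' := hw
    rw [hl, isWalk_append] at hw'
    obtain ⟨b, h₁, c, hbc, h₂⟩ := hw'
    rw [he, Sym2.eq_iff] at hbc
    rcases hbc with ⟨rfl, rfl⟩ | ⟨rfl, rfl⟩
    · exact ⟨l₁, e :: l₂, hl, h₁, y, he, h₂⟩
    · exact ⟨l₁ ++ [e], l₂, by simp [hl],
        isWalk_append.mpr ⟨y, h₁, x, by rw [he, Sym2.eq_swap], rfl⟩, h₂⟩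
  have hC : ∀ x y, Relation.EqvGen (fun x y => ∃ e, ends e = s(x, y)) x y → (C x ↔ C y) := by
    intro x y h
    induction h with
    | rel x y h =>
      obtain ⟨e, he⟩ := h
      have he' : ends e = s(y, x) := by rw [he, Sym2.eq_swap]
      exact ⟨fun h => hlC e y x he' (hCmem e x y he h), fun h => hlC e x y he (hCmem e y x he' h)⟩
    | refl => rfl
    | symm _ _ _ ih => exact ih.symm
    | trans _ _ _ _ _ ih₁ ih₂ => exact ih₁.trans ih₂
  refine ⟨a, l, hw, hnd, fun e => ?_⟩
  obtain ⟨x, y, he⟩ : ∃ x y, ends e = s(x, y) := by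
    induction h : ends e with
    | _ x y => exact ⟨x, y, rfl⟩
  exact hCmem e x y he ((hC a x (hconn a x)).mp ⟨[], l, rfl, rfl, hw⟩)

/-- The parity vectors of the edges of a connected graph generate all vectors of even weight. -/
theorem exists_subset_sum_pairParity [Fintype V] [Fintype E] {x y : E → V}
    (hconn : ∀ v w : V, Relation.EqvGen (fun v w => ∃ e, x e = v ∧ y e = w) v w)
    {f : V → ZMod 2} (hf : ∑ v, f v = 0) :
    ∃ ε : E → ZMod 2, ∑ e, ε e • pairParity (x e) (y e) = f := by
  rw [← Submodule.mem_span_range_iff_exists_fun]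
  set M := Submodule.span (ZMod 2) (Set.range fun e => pairParity (x e) (y e))
  have hpair : ∀ v w, Relation.EqvGen (fun v w => ∃ e, x e = v ∧ y e = w) v w →
      pairParity v w ∈ M := by
    intro v w h
    induction h with
    | rel v w h =>
      obtain ⟨e, rfl, rfl⟩ := h
      exact Submodule.subset_span ⟨e, rfl⟩
    | refl v => rw [pairParity_self]; exact M.zero_mem
    | symm _ _ _ ih => rwa [pairParity_comm]
    | trans u v w _ _ ih₁ ih₂ =>
      rw [← pairParity_add_pairParity u v w]
      exact M.add_mem ih₁ ih₂
  rcases isEmpty_or_nonempty V with hV | ⟨⟨v₀⟩⟩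
  · rw [Subsingleton.elim f 0]; exact M.zero_mem
  -- The contributions at the base point `v₀` add up to `∑ v, f v = 0`.
  · have hsum : f = ∑ v, f v • pairParity v₀ v := by
      have h1 : ∑ v, f v • (Pi.single v 1 : V → ZMod 2) = f := by
        ext w; simp [Finset.sum_apply, Pi.single_apply]
      have h2 : ∑ v, f v • (Pi.single v₀ 1 : V → ZMod 2) = 0 := by
        rw [← Finset.sum_smul, hf, zero_smul]
      simp only [pairParity, smul_add, Finset.sum_add_distrib, h1, h2, zero_add]
    rw [hsum]
    exact M.sum_mem fun v _ => M.smul_mem _ (hpair _ _ (hconn _ _))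

theorem sum_edgeParity_apply [Fintype V] (e : Sym2 V) : ∑ v, edgeParity e v = 0 := by
  induction e with
  | _ x y =>
    simp only [edgeParity_mk, pairParity, Pi.add_apply, Finset.sum_add_distrib,
      Finset.sum_pi_single', Finset.mem_univ, if_true]
    exact CharTwo.add_self_eq_zero 1

end Euler

/-- Let `{x i, y i, z i}` be a family of triples. If the edges `{x i, y i}` with `i ∈ F` form a
connected spanning graph, and so do those with `i ∉ F`, then one can select an edge from each
triple such that the selected edges form an Eulerian circuit: `{x i, y i}` is selected for `i ∈ F`,
and one of `{x i, z i}`, `{y i, z i}` for `i ∉ F`. -/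
theorem exists_closed_trail {V I : Type*} [Fintype V] [Nonempty V] [DecidableEq V] [Fintype I]
    (x y z : I → V) (F : Set I)
    (hF : ∀ v w : V, Relation.EqvGen (fun v w => ∃ i ∈ F, x i = v ∧ y i = w) v w)
    (hG : ∀ v w : V, Relation.EqvGen (fun v w => ∃ i ∉ F, x i = v ∧ y i = w) v w) :
    ∃ p c : ℕ → V, p (Fintype.card I) = p 0 ∧
      (∀ i, ∃ j < Fintype.card I, ({p j, c j, p (j + 1)} : Finset V) = {x i, y i, z i}) ∧
      ∀ j < Fintype.card I, ∃ i, ({p j, c j, p (j + 1)} : Finset V) = {x i, y i, z i} := by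
  classical
  let e₀ : I → Sym2 V := fun i => if i ∈ F then s(x i, y i) else s(x i, z i)
  have hsum : ∑ v, (∑ i, edgeParity (e₀ i)) v = 0 := by
    simp only [Finset.sum_apply]
    rw [Finset.sum_comm]
    exact Finset.sum_eq_zero fun i _ => sum_edgeParity_apply _
  -- The degree parities of the initial selection `e₀` are written as a sum of edges `xy` outside
  -- `F`. Indices in `F` are given loops, which have parity zero, so they are never switched.
  obtain ⟨ε, hε⟩ := exists_subset_sum_pairParity (x := x)
    (y := fun i => if i ∈ F then x i else y i)
    (fun v w => (hG v w).mono fun v w ⟨i, hi, hx, hy⟩ => ⟨i, hx, by simpa [hi] using hy⟩) hsum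
  let ends : I → Sym2 V := fun i =>
    if i ∈ F then s(x i, y i) else if ε i = 0 then s(x i, z i) else s(y i, z i)
  have heven : ∑ i, edgeParity (ends i) = 0 := by
    have hdiff : ∀ i, edgeParity (ends i) = edgeParity (e₀ i) +
        ε i • pairParity (x i) (if i ∈ F then x i else y i) := by
      intro i
      by_cases h : i ∈ F
      · simp [ends, e₀, h, pairParity_self]
      · by_cases h0 : ε i = 0
        · simp [ends, e₀, h, h0]
        · have h1 : ε i = 1 := by
            generalize ε i = a at h0
            revert a; decide
          simp only [ends, e₀, h, h0, if_false, edgeParity_mk]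
          rw [h1, one_smul, pairParity_comm (x i) (y i), add_comm, pairParity_add_pairParity]
    simp only [hdiff, Finset.sum_add_distrib, hε]
    ext v; exact CharTwo.add_self_eq_zero _
  obtain ⟨a, l, hw, hnd, hall⟩ := exists_eulerian_circuit heven
    (fun v w => (hF v w).mono fun v w ⟨i, hi, hx, hy⟩ => ⟨i, by simp [ends, hi, hx, hy]⟩)
    (Classical.arbitrary V)
  have hlen : l.length = Fintype.card I := by
    rw [← List.toFinset_card_of_nodup hnd, ← Finset.card_univ]
    congr 1
    ext i; simp [hall i]
  obtain ⟨p, hp0, hpl, hp⟩ := hw.exists_vertices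
  have hthird : ∀ i v w, ends i = s(v, w) → ∃ c, ({v, c, w} : Finset V) = {x i, y i, z i} := by
    intro i v w h
    have key : ∀ u₁ u₂ u₃ : V, s(u₁, u₂) = s(v, w) →
        ({v, u₃, w} : Finset V) = {u₁, u₂, u₃} := by
      intro u₁ u₂ u₃ h
      rcases Sym2.eq_iff.mp h with ⟨rfl, rfl⟩ | ⟨rfl, rfl⟩ <;> ext t <;> simp <;> tauto
    simp only [ends] at h
    split_ifs at h with h1 h2
    · exact ⟨z i, key _ _ _ h⟩
    · refine ⟨y i, (key _ _ _ h).trans ?_⟩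
      ext t; simp; tauto
    · refine ⟨x i, (key _ _ _ h).trans ?_⟩
      ext t; simp; tauto
  have hc : ∀ j, ∃ c, ∀ hj : j < l.length,
      ({p j, c, p (j + 1)} : Finset V) = {x l[j], y l[j], z l[j]} := by
    intro j
    by_cases hj : j < l.length
    · obtain ⟨c, hc⟩ := hthird _ _ _ (hp j hj)
      exact ⟨c, fun _ => hc⟩
    · exact ⟨a, fun h => absurd h hj⟩
  choose c hc using hc
  rw [← hlen]
  refine ⟨p, c, hpl.trans hp0.symm, fun i => ?_, fun j hj => ⟨_, hc j hj⟩⟩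
  obtain ⟨j, hj, rfl⟩ := List.getElem_of_mem (hall i)
  exact ⟨j, hj, hc j hj⟩

/-- A family of triples that covers all pairs, attains the Schönheim bound and has the connectivity
required in `exists_closed_trail` gives a minimum covering with a universal cycle. -/
theorem exists_cycle_of_family {V I : Type*} [Fintype V] [Nonempty V] [DecidableEq V] [Fintype I]
    {n : ℕ} (hn : Fintype.card V = n) (x y z : I → V)
    (hxy : ∀ i, x i ≠ y i) (hxz : ∀ i, x i ≠ z i) (hyz : ∀ i, y i ≠ z i)
    (hcov : ∀ v w, v ≠ w → ∃ i, v ∈ ({x i, y i, z i} : Finset V) ∧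
      w ∈ ({x i, y i, z i} : Finset V))
    (hI : 3 * Fintype.card I < n * (n / 2) + 3) (F : Set I)
    (hF : ∀ v w : V, Relation.EqvGen (fun v w => ∃ i ∈ F, x i = v ∧ y i = w) v w)
    (hG : ∀ v w : V, Relation.EqvGen (fun v w => ∃ i ∉ F, x i = v ∧ y i = w) v w) :
    ∃ A : Finset (Finset (Fin n)), IsMinimumCovering A ∧
      ∃ u : ZMod (2 * A.card) → Fin n, IsShiftUniversalCycle 2 3 A u := by
  obtain ⟨p, c, hp, h1, h2⟩ := exists_closed_trail x y z F hF hG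
  let e : V ≃ Fin n := Fintype.equivFinOfCardEq hn
  have himg : ∀ j, ({e (p j), e (c j), e (p (j + 1))} : Finset (Fin n)) =
      ({p j, c j, p (j + 1)} : Finset V).map e.toEmbedding := by
    intro j; simp
  refine exists_cycle_of_closed_trail hI (p := fun j => e (p j)) (c := fun j => e (c j))
    (congrArg e hp) (fun j hj => ?_) fun v w hvw => ?_
  · obtain ⟨i, hi⟩ := h2 j hj
    rw [himg, Finset.card_map, hi]
    exact Finset.card_eq_three.mpr ⟨_, _, _, hxy i, hxz i, hyz i, rfl⟩
  · obtain ⟨i, hv, hw⟩ := hcov (e.symm v) (e.symm w) (e.symm.injective.ne hvw)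
    obtain ⟨j, hj, hji⟩ := h1 i
    refine ⟨j, hj, ?_⟩
    rw [himg, hji, Finset.mem_map_equiv, Finset.mem_map_equiv]
    exact ⟨hv, hw⟩

/-! ### Coverings on three levels -/

/-- Three levels of `q` points each, together with further points `R`. -/
abbrev Pt (q : ℕ) (R : Type*) := (Fin q × Fin 3) ⊕ R

/-- Unordered pairs `{a, b}` of points of a level, encoded as `⟨b, a⟩` with `a < b`. -/
abbrev LevelPair (q : ℕ) := Σ b : Fin q, Fin b

theorem card_levelPair (q : ℕ) : Fintype.card (LevelPair q) * 2 = q * (q - 1) := by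
  rw [Fintype.card_sigma]
  simp only [Fintype.card_fin]
  rw [Fin.sum_univ_eq_sum_range (fun i => i), Finset.sum_range_id_mul_two]

namespace LevelPair

variable {q : ℕ}

/-- The smaller point of the pair. -/
def lo (k : LevelPair q) : Fin q := ⟨k.2, k.2.2.trans k.1.2⟩

/-- The larger point of the pair. -/
def hi (k : LevelPair q) : Fin q := k.1

theorem lo_lt_hi (k : LevelPair q) : k.lo < k.hi := k.2.2

theorem exists_eq {a b : Fin q} (h : a < b) : ∃ k : LevelPair q, k.lo = a ∧ k.hi = b :=
  ⟨⟨b, ⟨a, h⟩⟩, rfl, rfl⟩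

/-- The pairs used to connect consecutive levels. -/
def IsLink (k : LevelPair q) : Prop := k.hi.val = 4 ∧ k.lo.val < 2

instance (k : LevelPair q) : Decidable k.IsLink := inferInstanceAs (Decidable (_ ∧ _))

/-- The pairs of the first of the two spanning graphs. -/
def IsFirst (k : LevelPair q) : Prop :=
  k.hi.val = k.lo.val + 1 ∨ k.lo.val = 0 ∧ k.hi.val = 4

end LevelPair

theorem eqvGen_of_levels {q : ℕ} {R : Type*} (o : Fin q) {r : Pt q R → Pt q R → Prop}
    (hlevel : ∀ i a, Relation.EqvGen r (.inl (o, i)) (.inl (a, i)))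
    (hlink : ∀ i, ∃ a b, Relation.EqvGen r (.inl (a, i)) (.inl (b, i + 1)))
    (hR : ∀ s : R, ∃ v, Relation.EqvGen r (.inr s) (.inl v)) (v w : Pt q R) :
    Relation.EqvGen r v w := by
  have hsucc : ∀ i, Relation.EqvGen r (.inl (o, i)) (.inl (o, i + 1)) := fun i => by
    obtain ⟨a, b, hab⟩ := hlink i
    exact ((hlevel i a).trans _ _ _ hab).trans _ _ _ (hlevel (i + 1) b).symm
  have hbase : ∀ i, Relation.EqvGen r (.inl (o, 0)) (.inl (o, i)) := fun i => by
    fin_cases i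
    · exact .refl _
    · exact hsucc 0
    · exact (hsucc 0).trans _ _ _ (hsucc 1)
  have hinl : ∀ u, Relation.EqvGen r (.inl (o, 0)) (.inl u) := fun u =>
    (hbase u.2).trans _ _ _ (hlevel u.2 u.1)
  have hall : ∀ v, Relation.EqvGen r (.inl (o, 0)) v := by
    rintro (u | s)
    · exact hinl u
    · obtain ⟨u, hu⟩ := hR s
      exact (hinl u).trans _ _ _ hu.symm
  exact (hall v).symm.trans _ _ _ (hall w)

/-- A covering on three levels: for each level and each pair `{a, b}` in it there is a triple
consisting of `a`, `b` and the point `op a b` of the next level, where `op` is a commutative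
quasigroup with diagonal `σ`; the further triples `{x j, y j, z j}` cover the remaining pairs. -/
theorem exists_cycle_of_levels {q n : ℕ} (hq : 5 ≤ q) {R J : Type*} [Fintype R] [DecidableEq R]
    [Fintype J] (hn : 3 * q + Fintype.card R = n) {op : Fin q → Fin q → Fin q}
    (hcomm : ∀ a b, op a b = op b a) {σ : Fin q → Fin q}
    (hop : ∀ a d, d = σ a ∨ ∃ b, b ≠ a ∧ op a b = d) {x y z : J → Pt q R}
    (hdist : ∀ j, x j ≠ y j ∧ x j ≠ z j ∧ y j ≠ z j)
    (hσ : ∀ a i, ∃ j, .inl (a, i) ∈ ({x j, y j, z j} : Finset (Pt q R)) ∧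
      .inl (σ a, i + 1) ∈ ({x j, y j, z j} : Finset (Pt q R)))
    (hR : ∀ (s : R) v, v ≠ .inr s → ∃ j, .inr s ∈ ({x j, y j, z j} : Finset (Pt q R)) ∧
      v ∈ ({x j, y j, z j} : Finset (Pt q R)))
    (hJ : 9 * (q * (q - 1)) + 6 * Fintype.card J < 2 * (n * (n / 2)) + 6)
    (hRconn : ∀ s : R, ∃ j₁ j₂, j₁ ≠ j₂ ∧ (x j₁ = .inr s ∧ ∃ v, y j₁ = .inl v) ∧
      x j₂ = .inr s ∧ ∃ v, y j₂ = .inl v) :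
    ∃ A : Finset (Finset (Fin n)), IsMinimumCovering A ∧
      ∃ u : ZMod (2 * A.card) → Fin n, IsShiftUniversalCycle 2 3 A u := by
  let top : LevelPair q × Fin 3 → Pt q R := fun k => .inl (op k.1.lo k.1.hi, k.2 + 1)
  let x' : (LevelPair q × Fin 3) ⊕ J → Pt q R := Sum.elim (fun k => .inl (k.1.lo, k.2)) x
  let y' : (LevelPair q × Fin 3) ⊕ J → Pt q R :=
    -- For the pairs `{0, 4}` and `{1, 4}` the roles of `y` and `z` are exchanged, so that the edge
    -- `xy` leads to the next level. One of them serves each spanning graph.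
    Sum.elim (fun k => if k.1.IsLink then top k else .inl (k.1.hi, k.2)) y
  let z' : (LevelPair q × Fin 3) ⊕ J → Pt q R :=
    Sum.elim (fun k => if k.1.IsLink then .inl (k.1.hi, k.2) else top k) z
  have hne3 : ∀ i : Fin 3, i ≠ i + 1 := by decide
  have hlohi : ∀ k : LevelPair q, k.lo ≠ k.hi := fun k => k.lo_lt_hi.ne
  have hset : ∀ k, ({x' (.inl k), y' (.inl k), z' (.inl k)} : Finset (Pt q R)) =
      {.inl (k.1.lo, k.2), .inl (k.1.hi, k.2), top k} := by
    intro k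
    by_cases h : k.1.IsLink
    · simp only [x', y', z', Sum.elim_inl, h, if_true]
      rw [Finset.pair_comm]
    · simp only [x', y', z', Sum.elim_inl, h, if_false]
  have hdist' : ∀ i, x' i ≠ y' i ∧ x' i ≠ z' i ∧ y' i ≠ z' i := by
    rintro (k | j)
    · by_cases h : k.1.IsLink <;>
        simp [x', y', z', top, h, hlohi, hne3, (hne3 _).symm]
    · exact hdist j
  have hpair : ∀ a b : Fin q, a ≠ b → ∃ k : LevelPair q,
      (k.lo = a ∧ k.hi = b ∨ k.lo = b ∧ k.hi = a) := by
    intro a b hab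
    rcases lt_or_gt_of_ne hab with h | h
    · obtain ⟨k, hk⟩ := LevelPair.exists_eq h
      exact ⟨k, .inl hk⟩
    · obtain ⟨k, hk⟩ := LevelPair.exists_eq h
      exact ⟨k, .inr hk⟩
  let Cov : Pt q R → Pt q R → Prop := fun v w => ∃ i,
    v ∈ ({x' i, y' i, z' i} : Finset (Pt q R)) ∧ w ∈ ({x' i, y' i, z' i} : Finset (Pt q R))
  have hsymm : ∀ v w, Cov v w → Cov w v := fun v w ⟨i, h⟩ => ⟨i, h.2, h.1⟩
  have hsame : ∀ a b i, a ≠ b → Cov (.inl (a, i)) (.inl (b, i)) := by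
    intro a b i hab
    obtain ⟨k, hk⟩ := hpair a b hab
    refine ⟨.inl (k, i), ?_⟩
    rw [hset]
    rcases hk with ⟨rfl, rfl⟩ | ⟨rfl, rfl⟩ <;> simp
  have hnext : ∀ a d i, Cov (.inl (a, i)) (.inl (d, i + 1)) := by
    intro a d i
    rcases hop a d with rfl | ⟨b, hb, rfl⟩
    · obtain ⟨j, hj⟩ := hσ a i
      exact ⟨.inr j, hj⟩
    · obtain ⟨k, hk⟩ := hpair a b hb.symm
      refine ⟨.inl (k, i), ?_⟩
      rw [hset]
      rcases hk with ⟨rfl, rfl⟩ | ⟨rfl, rfl⟩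
      · simp [top]
      · simp [top, hcomm k.lo k.hi]
  have hcovR : ∀ s v, v ≠ .inr s → Cov (.inr s) v := fun s v hv => by
    obtain ⟨j, hj⟩ := hR s v hv
    exact ⟨.inr j, hj⟩
  have hcov : ∀ v w, v ≠ w → Cov v w := by
    rintro (⟨a, i⟩ | s) (⟨b, i'⟩ | s') hvw
    · have hi : ∀ i i' : Fin 3, i' = i ∨ i' = i + 1 ∨ i = i' + 1 := by decide
      rcases hi i i' with rfl | rfl | rfl
      · exact hsame a b _ (by rintro rfl; exact hvw rfl)
      · exact hnext a b i
      · exact hsymm _ _ (hnext b a i')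
    · exact hsymm _ _ (hcovR s' _ hvw)
    · exact hcovR s _ hvw.symm
    · exact hcovR s _ hvw.symm
  have hcard : 3 * Fintype.card ((LevelPair q × Fin 3) ⊕ J) < n * (n / 2) + 3 := by
    rw [Fintype.card_sum, Fintype.card_prod, Fintype.card_fin]
    have := card_levelPair q
    omega
  choose j₁ j₂ hj hj₁ hj₂ using hRconn
  -- Each extra point `s` is attached by `j₁ s` in the first graph and by `j₂ s` in the second.
  let F : Set ((LevelPair q × Fin 3) ⊕ J) :=
    Sum.elim (fun k => k.1.IsFirst) fun j => j ∈ Set.range j₁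
  have hFinl : ∀ k, Sum.inl k ∈ F ↔ k.1.IsFirst := fun k => Iff.rfl
  have hj₁F : ∀ s, Sum.inr (j₁ s) ∈ F := fun s => ⟨s, rfl⟩
  have hj₂F : ∀ s, Sum.inr (j₂ s) ∉ F := by
    rintro s ⟨s', hs'⟩
    have h1 := (hj₁ s').1
    rw [hs', (hj₂ s).1] at h1
    cases h1
    exact hj s hs'
  have hmk : ∀ {a b : ℕ} (hab : a < b) (hb : b < q), ∃ k : LevelPair q,
      k.lo = ⟨a, hab.trans hb⟩ ∧ k.hi = ⟨b, hb⟩ := fun hab hb => LevelPair.exists_eq hab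
  have : Nonempty (Pt q R) := ⟨.inl (⟨0, by omega⟩, 0)⟩
  have hcardPt : Fintype.card (Pt q R) = n := by
    rw [← hn]; simp [mul_comm]
  refine exists_cycle_of_family hcardPt x' y' z' (fun i => (hdist' i).1) (fun i => (hdist' i).2.1)
    (fun i => (hdist' i).2.2) hcov hcard F ?_ ?_
  -- First graph: each level is spanned by the path `0, 1, …, q - 1`, and `{0, 4}` links the levels.
  · have hstep : ∀ (a b : ℕ) (hab : a < b) (hb : b < q) (i : Fin 3), b = a + 1 →
        Relation.EqvGen (fun v w => ∃ i ∈ F, x' i = v ∧ y' i = w)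
          (.inl (⟨a, hab.trans hb⟩, i)) (.inl (⟨b, hb⟩, i)) := by
      intro a b hab hb i h
      obtain ⟨k, hlo, hhi⟩ := hmk hab hb
      refine .rel _ _ ⟨.inl (k, i), ?_, ?_, ?_⟩
      · rw [hFinl]; left; simp [hlo, hhi, h]
      · simp [x', hlo]
      · have : ¬ k.IsLink := by simp only [LevelPair.IsLink, hlo, hhi]; omega
        simp [y', this, hhi]
    refine eqvGen_of_levels ⟨0, by omega⟩ ?_ ?_ ?_
    · rintro i ⟨a, ha⟩
      induction a with
      | zero => exact .refl _
      | succ a ih => exact (ih (by omega)).trans _ _ _ (hstep a (a + 1) (by omega) ha i rfl)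
    · intro i
      obtain ⟨k, hlo, hhi⟩ := hmk (show 0 < 4 by omega) (by omega : 4 < q)
      refine ⟨k.lo, op k.lo k.hi, .rel _ _ ⟨.inl (k, i), ?_, rfl, ?_⟩⟩
      · rw [hFinl]; right; simp [hlo, hhi]
      · have : k.IsLink := by simp [LevelPair.IsLink, hlo, hhi]
        simp [y', this, top]
    · intro s
      obtain ⟨hx, v, hy⟩ := hj₁ s
      exact ⟨v, .rel _ _ ⟨.inr (j₁ s), hj₁F s, hx, hy⟩⟩
  -- Second graph: steps of length 2 connect each parity class of a level, `{0, 3}` joins the two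
  -- classes, and `{1, 4}` links the levels.
  · have hstep : ∀ (a b : ℕ) (hab : a < b) (hb : b < q) (i : Fin 3), b = a + 2 ∨ a = 0 ∧ b = 3 →
        Relation.EqvGen (fun v w => ∃ i ∉ F, x' i = v ∧ y' i = w)
          (.inl (⟨a, hab.trans hb⟩, i)) (.inl (⟨b, hb⟩, i)) := by
      intro a b hab hb i h
      obtain ⟨k, hlo, hhi⟩ := hmk hab hb
      refine .rel _ _ ⟨.inl (k, i), ?_, ?_, ?_⟩
      · rw [hFinl]; simp only [LevelPair.IsFirst, hlo, hhi]; omega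
      · simp [x', hlo]
      · have : ¬ k.IsLink := by simp only [LevelPair.IsLink, hlo, hhi]; omega
        simp [y', this, hhi]
    refine eqvGen_of_levels ⟨0, by omega⟩ ?_ ?_ ?_
    · rintro i ⟨a, ha⟩
      induction a using Nat.strong_induction_on with
      | _ a ih =>
        rcases Nat.lt_or_ge a 2 with h | h
        · interval_cases a
          · exact .refl _
          · exact (hstep 0 3 (by omega) (by omega) i (by omega)).trans _ _ _
              (hstep 1 3 (by omega) (by omega) i (by omega)).symm
        · exact (ih (a - 2) (by omega) (by omega)).trans _ _ _
            (hstep (a - 2) a (by omega) ha i (by omega))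
    · intro i
      obtain ⟨k, hlo, hhi⟩ := hmk (show 1 < 4 by omega) (by omega : 4 < q)
      refine ⟨k.lo, op k.lo k.hi, .rel _ _ ⟨.inl (k, i), ?_, rfl, ?_⟩⟩
      · rw [hFinl]; simp [LevelPair.IsFirst, hlo, hhi]
      · have : k.IsLink := by simp [LevelPair.IsLink, hlo, hhi]
        simp [y', this, top]
    · intro s
      obtain ⟨hx, v, hy⟩ := hj₂ s
      exact ⟨v, .rel _ _ ⟨.inr (j₂ s), hj₂F s, hx, hy⟩⟩

theorem exists_fin_three_eq_add_one (i : Fin 3) : ∃ i', i = i' + 1 := ⟨i + 2, by revert i; decide⟩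

/-! ### Levels of odd size: orders 3, 4, 5 modulo 6 -/

section Odd

/-- The idempotent commutative quasigroup `(a + b) / 2` on the integers modulo `2t + 1`. -/
def oddOp (t : ℕ) (a b : Fin (2 * t + 1)) : Fin (2 * t + 1) :=
  ⟨if (a.val + b.val) % 2 = 0 then (a.val + b.val) / 2
    else if a.val + b.val < 2 * t + 1 then (a.val + b.val + (2 * t + 1)) / 2
    else (a.val + b.val - (2 * t + 1)) / 2, by split_ifs <;> omega⟩

theorem oddOp_comm (t : ℕ) (a b : Fin (2 * t + 1)) : oddOp t a b = oddOp t b a := by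
  simp only [oddOp, add_comm]

/-- The solution is `b = 2d - a` modulo `2t + 1`; it equals `a` only if `d = a`, since 2 is
invertible. -/
theorem exists_oddOp_eq (t : ℕ) (a d : Fin (2 * t + 1)) :
    d = a ∨ ∃ b, b ≠ a ∧ oddOp t a b = d := by
  by_cases h : d = a
  · exact .inl h
  · have h' : d.val ≠ a.val := fun h' => h (Fin.ext h')
    refine .inr ⟨⟨if 2 * d.val < a.val then 2 * d.val + (2 * t + 1) - a.val
      else if 2 * d.val - a.val < 2 * t + 1 then 2 * d.val - a.val
      else 2 * d.val - a.val - (2 * t + 1), by split_ifs <;> omega⟩, ?_, ?_⟩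
    · rw [ne_eq, Fin.ext_iff]
      dsimp only
      split_ifs <;> omega
    · rw [Fin.ext_iff]
      simp only [oddOp]
      split_ifs <;> omega

/-- Bose's Steiner triple system: idempotence leaves the pairs `(a, i), (a, i + 1)`, covered by the
vertical triples. -/
theorem exists_cycle_six_mul_add_three {t : ℕ} (ht : 2 ≤ t) :
    ∃ A : Finset (Finset (Fin (6 * t + 3))), IsMinimumCovering A ∧
      ∃ u : ZMod (2 * A.card) → Fin (6 * t + 3), IsShiftUniversalCycle 2 3 A u := by
  refine exists_cycle_of_levels (q := 2 * t + 1) (R := Fin 0) (J := Fin (2 * t + 1)) (by omega)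
    (by simp; ring) (oddOp_comm t) (σ := id) (exists_oddOp_eq t)
    (x := fun a => .inl (a, 0)) (y := fun a => .inl (a, 1)) (z := fun a => .inl (a, 2))
    (by simp) ?_ (fun s => s.elim0) ?_ (fun s => s.elim0)
  · intro a i
    refine ⟨a, ?_⟩
    fin_cases i <;> simp
  · rw [Fintype.card_fin, show (6 * t + 3) / 2 = 3 * t + 1 by omega, Nat.add_sub_cancel]
    nlinarith

/-- One point is added to Bose's system. Its triples match level 0 with level 1 and cover level 2 by
the `t + 1` pairs `{a, a + t}`, which overlap only in `t`. -/
theorem exists_cycle_six_mul_add_four {t : ℕ} (ht : 2 ≤ t) :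
    ∃ A : Finset (Finset (Fin (6 * t + 4))), IsMinimumCovering A ∧
      ∃ u : ZMod (2 * A.card) → Fin (6 * t + 4), IsShiftUniversalCycle 2 3 A u := by
  let sh : Fin (t + 1) → Fin (2 * t + 1) := fun a => ⟨a, by omega⟩
  let sh' : Fin (t + 1) → Fin (2 * t + 1) := fun a => ⟨a + t, by omega⟩
  have hsh : ∀ a, sh a ≠ sh' a := fun a => by simp [sh, sh', Fin.ext_iff]; omega
  refine exists_cycle_of_levels (q := 2 * t + 1) (R := Unit)
    (J := Fin (2 * t + 1) ⊕ Fin (2 * t + 1) ⊕ Fin (t + 1)) (by omega)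
    (by simp; ring) (oddOp_comm t) (σ := id) (exists_oddOp_eq t)
    (x := Sum.elim (fun a => .inl (a, 0)) (Sum.elim (fun _ => .inr ()) fun _ => .inr ()))
    (y := Sum.elim (fun a => .inl (a, 1))
      (Sum.elim (fun a => .inl (a, 0)) fun a => .inl (sh a, 2)))
    (z := Sum.elim (fun a => .inl (a, 2))
      (Sum.elim (fun a => .inl (a, 1)) fun a => .inl (sh' a, 2)))
    (by rintro (a | a | a) <;> simp [hsh]) ?_ ?_ ?_ ?_
  · intro a i
    refine ⟨.inl a, ?_⟩
    fin_cases i <;> simp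
  · rintro s (⟨a, i⟩ | s') h
    · fin_cases i
      · exact ⟨.inr (.inl a), by simp⟩
      · exact ⟨.inr (.inl a), by simp⟩
      · rcases Nat.lt_or_ge a.val (t + 1) with ha | ha
        · exact ⟨.inr (.inr ⟨a, ha⟩), by simp [sh]⟩
        · refine ⟨.inr (.inr ⟨a - t, by omega⟩), by simp, ?_⟩
          have : sh' ⟨a - t, by omega⟩ = a := by simp only [sh', Fin.ext_iff]; omega
          simp [this]
    · exact absurd rfl h
  · simp only [Fintype.card_sum, Fintype.card_fin]
    rw [show (6 * t + 4) / 2 = 3 * t + 2 by omega, Nat.add_sub_cancel]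
    nlinarith
  · intro s
    exact ⟨.inr (.inl ⟨0, by omega⟩), .inr (.inl ⟨1, by omega⟩), by simp, by simp, by simp⟩

/-- Negation modulo `2t + 1`. -/
def oddNeg (t : ℕ) (a : Fin (2 * t + 1)) : Fin (2 * t + 1) :=
  ⟨if a.val = 0 then 0 else 2 * t + 1 - a.val, by split_ifs <;> omega⟩

theorem oddNeg_oddNeg (t : ℕ) (a : Fin (2 * t + 1)) : oddNeg t (oddNeg t a) = a := by
  simp only [oddNeg, Fin.ext_iff]
  split_ifs <;> omega

/-- With the diagonal `a ↦ -a`, the uncovered pairs between levels form a triangle on the zeros and,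
for each `{a, -a}` with `a ≠ 0`, a hexagon. A hexagon splits into two perfect matchings, one for
each extra point. The three zeros and the two extra points carry a covering of five points by four
triples. -/
theorem exists_cycle_six_mul_add_five {t : ℕ} (ht : 2 ≤ t) :
    ∃ A : Finset (Finset (Fin (6 * t + 5))), IsMinimumCovering A ∧
      ∃ u : ZMod (2 * A.card) → Fin (6 * t + 5), IsShiftUniversalCycle 2 3 A u := by
  let o : Fin (2 * t + 1) := 0
  -- `pos c` and `neg c` are the residues `c + 1` and `-(c + 1)`.
  let pos : Fin t → Fin (2 * t + 1) := fun a => ⟨a + 1, by omega⟩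
  let neg : Fin t → Fin (2 * t + 1) := fun a => ⟨2 * t - a, by omega⟩
  have hcases : ∀ a, (a = o ∧ oddNeg t a = o) ∨ (∃ c, a = pos c ∧ oddNeg t a = neg c) ∨
      ∃ c, a = neg c ∧ oddNeg t a = pos c := by
    intro a
    by_cases h0 : a.val = 0
    · exact .inl ⟨Fin.ext h0, by simp [oddNeg, h0, o]⟩
    · rcases Nat.lt_or_ge t a.val with ha | ha
      · refine .inr (.inr ⟨⟨2 * t - a, by omega⟩, ?_⟩)
        simp only [oddNeg, pos, neg, Fin.ext_iff, h0, if_false]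
        omega
      · refine .inr (.inl ⟨⟨a - 1, by omega⟩, ?_⟩)
        simp only [oddNeg, pos, neg, Fin.ext_iff, h0, if_false]
        omega
  have hne3 : ∀ i : Fin 3, i ≠ i + 1 := by decide
  refine exists_cycle_of_levels (q := 2 * t + 1) (R := Fin 2)
    (J := ((Fin t × Fin 3) ⊕ (Fin t × Fin 3)) ⊕ Unit ⊕ Fin 3) (by omega)
    (by simp; ring) (op := fun a b => oddNeg t (oddOp t a b))
    (fun a b => by rw [oddOp_comm]) (σ := oddNeg t) ?_
    (x := Sum.elim (Sum.elim (fun _ => .inr 0) fun _ => .inr 1)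
      (Sum.elim (fun _ => .inl (o, 0)) fun _ => .inr 0))
    (y := Sum.elim (Sum.elim (fun j => .inl (pos j.1, j.2)) fun j => .inl (neg j.1, j.2))
      (Sum.elim (fun _ => .inl (o, 1)) fun _ => .inr 1))
    (z := Sum.elim (Sum.elim (fun j => .inl (neg j.1, j.2 + 1)) fun j => .inl (pos j.1, j.2 + 1))
      (Sum.elim (fun _ => .inl (o, 2)) fun i => .inl (o, i)))
    (by rintro ((j | j) | j | i) <;> simp [hne3]) ?_ ?_ ?_ ?_
  · intro a d
    rcases exists_oddOp_eq t a (oddNeg t d) with h | ⟨b, hb, h⟩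
    · exact .inl (by rw [← h, oddNeg_oddNeg])
    · exact .inr ⟨b, hb, by rw [h, oddNeg_oddNeg]⟩
  · intro a i
    rcases hcases a with ⟨h, h'⟩ | ⟨c, h, h'⟩ | ⟨c, h, h'⟩ <;> rw [h'] <;> subst h
    · refine ⟨.inr (.inl ()), ?_⟩
      fin_cases i <;> simp
    · exact ⟨.inl (.inl (c, i)), by simp⟩
    · exact ⟨.inl (.inr (c, i)), by simp⟩
  · rintro s (⟨a, i⟩ | s') h
    · obtain ⟨i', hi'⟩ := exists_fin_three_eq_add_one i
      rcases hcases a with ⟨rfl, -⟩ | ⟨c, rfl, -⟩ | ⟨c, rfl, -⟩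
      · refine ⟨.inr (.inr i), ?_⟩
        fin_cases s <;> simp
      · fin_cases s
        · exact ⟨.inl (.inl (c, i)), by simp⟩
        · exact ⟨.inl (.inr (c, i')), by simp [hi']⟩
      · fin_cases s
        · exact ⟨.inl (.inl (c, i')), by simp [hi']⟩
        · exact ⟨.inl (.inr (c, i)), by simp⟩
    · refine ⟨.inr (.inr 0), ?_⟩
      fin_cases s <;> fin_cases s' <;> simp
  · simp only [Fintype.card_sum, Fintype.card_prod, Fintype.card_fin, Fintype.card_unit]
    rw [show (6 * t + 5) / 2 = 3 * t + 2 by omega, Nat.add_sub_cancel]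
    nlinarith
  · intro s
    fin_cases s
    · exact ⟨.inl (.inl (⟨0, by omega⟩, 0)), .inl (.inl (⟨0, by omega⟩, 1)), by simp, by simp,
        by simp⟩
    · exact ⟨.inl (.inr (⟨0, by omega⟩, 0)), .inl (.inr (⟨0, by omega⟩, 1)), by simp, by simp,
        by simp⟩

end Odd

/-! ### Levels of even size: orders 0, 1, 2 modulo 6 -/

section Even

/-- The half-idempotent commutative quasigroup on `2t` points. -/
def evenOp (t : ℕ) (a b : Fin (2 * t)) : Fin (2 * t) :=
  ⟨if (a.val + b.val) % 2 = 0 then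
      if a.val + b.val < 2 * t then (a.val + b.val) / 2 else (a.val + b.val - 2 * t) / 2
    else if a.val + b.val < 2 * t then t + (a.val + b.val) / 2
      else t + (a.val + b.val - 2 * t) / 2, by split_ifs <;> omega⟩

/-- The diagonal of `evenOp`. -/
def evenDiag (t : ℕ) (a : Fin (2 * t)) : Fin (2 * t) :=
  ⟨if a.val < t then a.val else a.val - t, by split_ifs <;> omega⟩

theorem evenOp_comm (t : ℕ) (a b : Fin (2 * t)) : evenOp t a b = evenOp t b a := by
  simp only [evenOp, add_comm]

/-- `evenOp` is addition modulo `2t` with the sums relabelled: even ones fill the lower half, odd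
ones the upper half. If `s` is the sum labelled `d`, then `b = s - a`, and `b = a` forces `s = 2a`,
that is, `d = evenDiag t a`. -/
theorem exists_evenOp_eq (t : ℕ) (a d : Fin (2 * t)) :
    d = evenDiag t a ∨ ∃ b, b ≠ a ∧ evenOp t a b = d := by
  by_cases h : d = evenDiag t a
  · exact .inl h
  · obtain ⟨s, hs, hsd⟩ : ∃ s, s < 2 * t ∧ d.val = if s % 2 = 0 then s / 2 else t + s / 2 := by
      rcases Nat.lt_or_ge d.val t with hd | hd
      · exact ⟨2 * d.val, by omega, by rw [if_pos (by omega)]; omega⟩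
      · exact ⟨2 * (d.val - t) + 1, by omega, by rw [if_neg (by omega)]; omega⟩
    rw [evenDiag, Fin.ext_iff] at h
    dsimp only at h
    refine .inr ⟨⟨if a.val ≤ s then s - a.val else s + 2 * t - a.val, by split_ifs <;> omega⟩,
      ?_, ?_⟩
    · rw [ne_eq, Fin.ext_iff]
      dsimp only
      split_ifs at h hsd ⊢ <;> omega
    · rw [Fin.ext_iff]
      simp only [evenOp]
      split_ifs at hsd ⊢ <;> omega

/-- The points of the lower half. -/
def evenLow {t : ℕ} (a : Fin t) : Fin (2 * t) := ⟨a, by omega⟩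

/-- The points of the upper half. -/
def evenHigh {t : ℕ} (a : Fin t) : Fin (2 * t) := ⟨a + t, by omega⟩

theorem evenLow_ne_evenHigh {t : ℕ} (a : Fin t) : evenLow a ≠ evenHigh a := by
  simp only [evenLow, evenHigh, ne_eq, Fin.ext_iff]; omega

theorem evenDiag_cases {t : ℕ} (a : Fin (2 * t)) :
    (∃ c, a = evenLow c ∧ evenDiag t a = evenLow c) ∨
      ∃ c, a = evenHigh c ∧ evenDiag t a = evenLow c := by
  rcases Nat.lt_or_ge a.val t with ha | ha
  · exact .inl ⟨⟨a, ha⟩, rfl, by simp [evenDiag, evenLow, ha]⟩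
  · refine .inr ⟨⟨a - t, by omega⟩, ?_⟩
    simp only [evenDiag, evenLow, evenHigh, Fin.ext_iff]
    split_ifs <;> omega

/-- Points `c` and `c + t` have the same diagonal value `c`, so one triple covers both missing
pairs; the only repeated pairs are `{c, c + t}` within each level. -/
theorem exists_cycle_six_mul {t : ℕ} (ht : 3 ≤ t) :
    ∃ A : Finset (Finset (Fin (6 * t))), IsMinimumCovering A ∧
      ∃ u : ZMod (2 * A.card) → Fin (6 * t), IsShiftUniversalCycle 2 3 A u := by
  have hne3 : ∀ i : Fin 3, i ≠ i + 1 := by decide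
  refine exists_cycle_of_levels (q := 2 * t) (R := Fin 0) (J := Fin t × Fin 3) (by omega)
    (by simp; ring) (evenOp_comm t) (exists_evenOp_eq t)
    (x := fun j => .inl (evenLow j.1, j.2)) (y := fun j => .inl (evenHigh j.1, j.2))
    (z := fun j => .inl (evenLow j.1, j.2 + 1))
    (by simp [hne3, evenLow_ne_evenHigh]) ?_ (fun s => s.elim0) ?_ (fun s => s.elim0)
  · intro a i
    rcases evenDiag_cases a with ⟨c, h, h'⟩ | ⟨c, h, h'⟩ <;> rw [h'] <;> subst h <;>
      exact ⟨(c, i), by simp⟩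
  · simp only [Fintype.card_prod, Fintype.card_fin]
    obtain ⟨k, rfl⟩ : ∃ k, t = k + 1 := ⟨t - 1, by omega⟩
    rw [show 6 * (k + 1) / 2 = 3 * k + 3 by omega, show 2 * (k + 1) - 1 = 2 * k + 1 by omega]
    nlinarith

/-- Skolem's Steiner triple system: vertical triples serve the idempotent lower half, and the
missing pairs from the upper half form a perfect matching, which is joined to the extra point. -/
theorem exists_cycle_six_mul_add_one {t : ℕ} (ht : 3 ≤ t) :
    ∃ A : Finset (Finset (Fin (6 * t + 1))), IsMinimumCovering A ∧
      ∃ u : ZMod (2 * A.card) → Fin (6 * t + 1), IsShiftUniversalCycle 2 3 A u := by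
  have hne3 : ∀ i : Fin 3, i ≠ i + 1 := by decide
  refine exists_cycle_of_levels (q := 2 * t) (R := Unit) (J := Fin t ⊕ (Fin t × Fin 3)) (by omega)
    (by simp; ring) (evenOp_comm t) (exists_evenOp_eq t)
    (x := Sum.elim (fun a => .inl (evenLow a, 0)) fun _ => .inr ())
    (y := Sum.elim (fun a => .inl (evenLow a, 1)) fun j => .inl (evenHigh j.1, j.2))
    (z := Sum.elim (fun a => .inl (evenLow a, 2)) fun j => .inl (evenLow j.1, j.2 + 1))
    (by rintro (a | j) <;> simp [hne3]) ?_ ?_ ?_ ?_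
  · intro a i
    rcases evenDiag_cases a with ⟨c, h, h'⟩ | ⟨c, h, h'⟩ <;> rw [h'] <;> subst h
    · refine ⟨.inl c, ?_⟩
      fin_cases i <;> simp
    · exact ⟨.inr (c, i), by simp⟩
  · rintro s (⟨a, i⟩ | s') h
    · obtain ⟨i', rfl⟩ := exists_fin_three_eq_add_one i
      rcases evenDiag_cases a with ⟨c, rfl, -⟩ | ⟨c, rfl, -⟩
      · exact ⟨.inr (c, i'), by simp⟩
      · exact ⟨.inr (c, i' + 1), by simp⟩
    · exact absurd rfl h
  · simp only [Fintype.card_sum, Fintype.card_prod, Fintype.card_fin]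
    obtain ⟨k, rfl⟩ : ∃ k, t = k + 1 := ⟨t - 1, by omega⟩
    rw [show (6 * (k + 1) + 1) / 2 = 3 * k + 3 by omega,
      show 2 * (k + 1) - 1 = 2 * k + 1 by omega]
    nlinarith
  · intro s
    exact ⟨.inr (⟨0, by omega⟩, 0), .inr (⟨0, by omega⟩, 1), by simp, by simp, by simp⟩

/-- The extra point of Skolem's system is doubled, and one more triple covers the pair of extra
points. -/
theorem exists_cycle_six_mul_add_two {t : ℕ} (ht : 3 ≤ t) :
    ∃ A : Finset (Finset (Fin (6 * t + 2))), IsMinimumCovering A ∧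
      ∃ u : ZMod (2 * A.card) → Fin (6 * t + 2), IsShiftUniversalCycle 2 3 A u := by
  have hne3 : ∀ i : Fin 3, i ≠ i + 1 := by decide
  let o : Fin (2 * t) := ⟨0, by omega⟩
  refine exists_cycle_of_levels (q := 2 * t) (R := Fin 2)
    (J := Fin t ⊕ ((Fin t × Fin 3) × Fin 2) ⊕ Unit) (by omega)
    (by simp; ring) (evenOp_comm t) (exists_evenOp_eq t)
    (x := Sum.elim (fun a => .inl (evenLow a, 0)) (Sum.elim (fun j => .inr j.2) fun _ => .inr 0))
    (y := Sum.elim (fun a => .inl (evenLow a, 1))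
      (Sum.elim (fun j => .inl (evenHigh j.1.1, j.1.2)) fun _ => .inr 1))
    (z := Sum.elim (fun a => .inl (evenLow a, 2))
      (Sum.elim (fun j => .inl (evenLow j.1.1, j.1.2 + 1)) fun _ => .inl (o, 0)))
    (by rintro (a | j | j) <;> simp [hne3]) ?_ ?_ ?_ ?_
  · intro a i
    rcases evenDiag_cases a with ⟨c, h, h'⟩ | ⟨c, h, h'⟩ <;> rw [h'] <;> subst h
    · refine ⟨.inl c, ?_⟩
      fin_cases i <;> simp
    · exact ⟨.inr (.inl ((c, i), 0)), by simp⟩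
  · rintro s (⟨a, i⟩ | s') h
    · obtain ⟨i', rfl⟩ := exists_fin_three_eq_add_one i
      rcases evenDiag_cases a with ⟨c, rfl, -⟩ | ⟨c, rfl, -⟩
      · exact ⟨.inr (.inl ((c, i'), s)), by simp⟩
      · exact ⟨.inr (.inl ((c, i' + 1), s)), by simp⟩
    · refine ⟨.inr (.inr ()), ?_⟩
      fin_cases s <;> fin_cases s' <;> simp
  · simp only [Fintype.card_sum, Fintype.card_prod, Fintype.card_fin, Fintype.card_unit]
    obtain ⟨k, rfl⟩ : ∃ k, t = k + 1 := ⟨t - 1, by omega⟩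
    rw [show (6 * (k + 1) + 2) / 2 = 3 * k + 4 by omega,
      show 2 * (k + 1) - 1 = 2 * k + 1 by omega]
    nlinarith
  · intro s
    exact ⟨.inr (.inl ((⟨0, by omega⟩, 0), s)), .inr (.inl ((⟨0, by omega⟩, 1), s)), by simp,
      by simp, by simp⟩

end Even

/-! ### Small orders -/

/-- A universal cycle given by an explicit list `p_0, c_0, p_1, c_1, …`. -/
theorem exists_cycle_of_list {n : ℕ} [NeZero n] (m : ℕ) (l : List (Fin n))
    (hm : 3 * m < n * (n / 2) + 3) (hl : l.getD (2 * m) 0 = l.getD 0 0)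
    (h3 : ∀ i < m, l.getD (2 * i) 0 ≠ l.getD (2 * i + 1) 0 ∧
      l.getD (2 * i) 0 ≠ l.getD (2 * i + 2) 0 ∧ l.getD (2 * i + 1) 0 ≠ l.getD (2 * i + 2) 0)
    (hcov : ∀ x y : Fin n, x ≠ y → ∃ i < m,
      (x = l.getD (2 * i) 0 ∨ x = l.getD (2 * i + 1) 0 ∨ x = l.getD (2 * i + 2) 0) ∧
      (y = l.getD (2 * i) 0 ∨ y = l.getD (2 * i + 1) 0 ∨ y = l.getD (2 * i + 2) 0)) :
    ∃ A : Finset (Finset (Fin n)), IsMinimumCovering A ∧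
      ∃ u : ZMod (2 * A.card) → Fin n, IsShiftUniversalCycle 2 3 A u := by
  refine exists_cycle_of_closed_trail hm (p := fun i => l.getD (2 * i) 0)
    (c := fun i => l.getD (2 * i + 1) 0) hl (fun i hi => ?_) fun x y hxy => ?_
  · obtain ⟨h1, h2, h3⟩ := h3 i hi
    exact Finset.card_eq_three.mpr ⟨_, _, _, h1, h2, h3, rfl⟩
  · obtain ⟨i, hi, h⟩ := hcov x y hxy
    refine ⟨i, hi, ?_⟩
    simpa [mul_add] using h

/-- Below 15 points three levels cannot have five points each, as the spanning graphs require. Each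
list has `2m + 1` entries, its first point repeated at the end, so the default value of `getD` is
never used. -/
theorem exists_cycle_of_lt_fifteen {n : ℕ} (hn : 4 ≤ n) (hn' : n < 15) :
    ∃ A : Finset (Finset (Fin n)), IsMinimumCovering A ∧
      ∃ u : ZMod (2 * A.card) → Fin n, IsShiftUniversalCycle 2 3 A u := by
  interval_cases n
  · exact exists_cycle_of_list 3 [0, 3, 1, 3, 2, 3, 0]
      (by decide) (by decide) (by decide +kernel) (by decide +kernel)
  · exact exists_cycle_of_list 4 [4, 3, 0, 2, 1, 4, 3, 2, 4]
      (by decide) (by decide) (by decide +kernel) (by decide +kernel)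
  · exact exists_cycle_of_list 6 [1, 0, 3, 4, 2, 3, 5, 1, 4, 5, 0, 2, 1]
      (by decide) (by decide) (by decide +kernel) (by decide +kernel)
  · exact exists_cycle_of_list 7 [0, 3, 1, 5, 4, 6, 3, 2, 5, 0, 6, 1, 2, 4, 0]
      (by decide) (by decide) (by decide +kernel) (by decide +kernel)
  · exact exists_cycle_of_list 11 [3, 0, 1, 7, 2, 3, 5, 1, 4, 3, 7, 0, 5, 0, 6, 1, 2, 4, 0, 7,
      6, 4, 3]
      (by decide) (by decide) (by decide +kernel) (by decide +kernel)
  · exact exists_cycle_of_list 12 [0, 5, 1, 8, 6, 4, 5, 8, 2, 0, 4, 1, 7, 5, 3, 1, 2, 7, 6, 0,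
      3, 4, 8, 7, 0]
      (by decide) (by decide) (by decide +kernel) (by decide +kernel)
  · exact exists_cycle_of_list 17 [0, 5, 1, 2, 3, 5, 7, 0, 8, 5, 2, 7, 6, 8, 1, 4, 7, 9, 8, 3,
      4, 1, 9, 7, 6, 4, 5, 9, 2, 4, 0, 6, 3, 9, 0]
      (by decide) (by decide) (by decide +kernel) (by decide +kernel)
  · exact exists_cycle_of_list 19 [1, 7, 6, 2, 8, 5, 3, 1, 2, 4, 10, 0, 9, 5, 1, 4, 0, 7, 8, 4,
      9, 7, 2, 0, 5, 6, 4, 3, 7, 5, 10, 9, 3, 0, 6, 9, 10, 8, 1]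
      (by decide) (by decide) (by decide +kernel) (by decide +kernel)
  · exact exists_cycle_of_list 24 [1, 2, 7, 0, 3, 4, 1, 6, 0, 2, 5, 10, 4, 9, 6, 5, 11, 8, 3, 9,
      10, 8, 1, 5, 3, 6, 2, 8, 9, 11, 0, 2, 4, 11, 7, 8, 5, 9, 7, 10, 6, 4, 8, 0, 10, 2, 11, 9, 1]
      (by decide) (by decide) (by decide +kernel) (by decide +kernel)
  · exact exists_cycle_of_list 26 [6, 4, 9, 2, 8, 3, 11, 5, 6, 0, 1, 3, 4, 5, 10, 7, 6, 3, 2, 1,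
      7, 11, 4, 0, 8, 5, 7, 3, 0, 10, 12, 4, 2, 0, 5, 1, 9, 10, 3, 5, 12, 7, 9, 0, 11, 2, 10, 8, 1,
      11, 12, 8, 6]
      (by decide) (by decide) (by decide +kernel) (by decide +kernel)
  · exact exists_cycle_of_list 33 [6, 3, 2, 9, 8, 11, 3, 7, 0, 2, 5, 11, 6, 0, 1, 3, 4, 5, 10,
      7, 6, 4, 9, 3, 10, 8, 1, 2, 7, 11, 4, 0, 8, 6, 12, 4, 2, 4, 13, 10, 0, 9, 11, 2, 10, 0, 12, 7,
      9, 13, 7, 8, 5, 12, 3, 13, 5, 9, 1, 13, 11, 1, 12, 0, 13, 8, 6]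
      (by decide) (by decide) (by decide +kernel) (by decide +kernel)

end PairCovering

theorem mainTheorem2 (n : ℕ) (hn : 4 ≤ n) :
    ∃ A : Finset (Finset (Fin n)), PairCovering.IsMinimumCovering A ∧
      ∃ u : ZMod (2 * A.card) → Fin n, PairCovering.IsShiftUniversalCycle 2 3 A u := by
  rcases Nat.lt_or_ge n 15 with h | h
  · exact PairCovering.exists_cycle_of_lt_fifteen hn h
  · obtain ⟨t, ht⟩ : ∃ t, n = 6 * t ∨ n = 6 * t + 1 ∨ n = 6 * t + 2 ∨ n = 6 * t + 3 ∨
        n = 6 * t + 4 ∨ n = 6 * t + 5 := ⟨n / 6, by omega⟩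
    rcases ht with rfl | rfl | rfl | rfl | rfl | rfl
    · exact PairCovering.exists_cycle_six_mul (by omega)
    · exact PairCovering.exists_cycle_six_mul_add_one (by omega)
    · exact PairCovering.exists_cycle_six_mul_add_two (by omega)
    · exact PairCovering.exists_cycle_six_mul_add_three (by omega)
    · exact PairCovering.exists_cycle_six_mul_add_four (by omega)
    · exact PairCovering.exists_cycle_six_mul_add_five (by omega)
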